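/- Let $q\in\mathbb C\setminus\{0\}$ and let $0\le n<m$ be integers. Let $\mathcal A$ be the $\mathbb C$-algebra of formal power series in the non-commuting variables $a_{ij}$, $1\le i,j\le m$. A matrix $A=(a_{ij})_{m\times m}$ is called $q$-Cartier-Foata if $$a_{jl}a_{ik}=a_{ik}a_{jl}\ (i<j,\ k<l),\qquad a_{jl}a_{ik}=q^2a_{ik}a_{jl}\ (i<j,\ k>l),\qquad a_{jk}a_{ik}=q\,a_{ik}a_{jk}\ (i<j).$$ For a square matrix $B=(b_{ij})_{r\times r}$ whose entries are polynomials in the $a_{ij}$, the $q$-determinant $\det_q B$ is obtained by expanding $\sum_{\sigma\in S_r}(-1)^{\operatorname{inv}\sigma}b_{\sigma(1)1}\cdots b_{\sigma(r)r}$ into words in the variables and multiplying each word $a_{\lambda_1\mu_1}\cdots a_{\lambda_\ell\mu_\ell}$ by $q^{\operatorname{inv}\mu-\operatorname{inv}\lambda}$, where $\operatorname{inv}\nu=|\{(s,t):s<t,\ \nu_s>\nu_t\}|$. In particular $$\textstyle\det_q(I-A)=\sum_{J\subseteq[m]}(-1)^{|J|}\sum_{\sigma\in S_J}(-q)^{-\operatorname{inv}\sigma}a_{\sigma(j_1)j_1}\cdots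 a_{\sigma(j_s)j_s},\qquad J=\{j_1<\dots<j_s\},$$ and $\det_q(I-X)$ is defined by the same polynomial expression in the entries of $X$ for every square matrix $X$ over a $\mathbb C$-algebra. Let $A=(a_{ij})_{m\times m}$ be $q$-Cartier-Foata, that is, consider the $a_{ij}$ as elements of the quotient of $\mathcal A$ by the two-sided ideal generated by the relations above (or of the image of this quotient under a $\mathbb C$-algebra homomorphism). Put $A_0=(a_{ij})_{1\le i,j\le n}$, $a_{i*}=(a_{i1},\dots,a_{in})$, $a_{*j}=(a_{1j},\dots,a_{nj})^{T}$. Then $\det_q(I-A_0)$ is invertible, and for $$c^q_{ij}=-{\textstyle\det_q}^{-1}(I-A_0)\cdot{\textstyle\det_q}\begin{pmatrix}I-A_0&-a_{*j}\\-a_{i*}&-a_{ij}\end{pmatrix},\qquad C^q=(c^q_{ij})_{n+1\le i,j\le m},$$ one has $${\textstyle\det_q}^{-1}(I-A_0)\cdot{\textstyle\det_q}(I-A)={\textstyle\det_q}(I-C^q).$$ -/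

import Mathlib

/-! ### Formal power series in non-commuting variables -/

/-- Formal power series over `K` in non-commuting variables indexed by `σ`: arbitrary families of
coefficients indexed by the words (finite lists) in the variables. -/
def NCPowerSeries (σ K : Type*) : Type _ := List σ → K

namespace NCPowerSeries

variable {σ K : Type*}

instance [AddCommGroup K] : AddCommGroup (NCPowerSeries σ K) :=
  inferInstanceAs (AddCommGroup (List σ → K))

instance [CommRing K] : Module K (NCPowerSeries σ K) :=
  inferInstanceAs (Module K (List σ → K))

@[ext] theorem ext {f g : NCPowerSeries σ K} (h : ∀ w, f w = g w) : f = g := funext h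

/-- The series consisting of the empty word with coefficient `1`. -/
instance [CommRing K] : One (NCPowerSeries σ K) :=
  ⟨fun w => match w with
    | [] => 1
    | _ :: _ => 0⟩

/-- Concatenation product: the coefficient of `w` in `f * g` is the sum of `f u * g v` over all
factorizations `w = u v`. -/
instance [CommRing K] : Mul (NCPowerSeries σ K) :=
  ⟨fun f g w => ∑ i ∈ Finset.range (w.length + 1), f (w.take i) * g (w.drop i)⟩

/-- The series consisting of the single variable `s` with coefficient `1`. -/
noncomputable def X [CommRing K] (s : σ) : NCPowerSeries σ K :=
  open scoped Classical in fun w => if w = [s] then 1 else 0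

section Ring

variable [CommRing K]

/-- The part of `f` made of the words starting with `x`, with this first letter removed. -/
def tail (f : NCPowerSeries σ K) (x : σ) : NCPowerSeries σ K := fun w => f (x :: w)

theorem add_apply (f g : NCPowerSeries σ K) (w : List σ) : (f + g) w = f w + g w := rfl

theorem zero_apply (w : List σ) : (0 : NCPowerSeries σ K) w = 0 := rfl

theorem smul_apply (c : K) (f : NCPowerSeries σ K) (w : List σ) : (c • f) w = c * f w := rfl

theorem one_nil : (1 : NCPowerSeries σ K) [] = 1 := rfl

theorem one_cons (x : σ) (w : List σ) : (1 : NCPowerSeries σ K) (x :: w) = 0 := rfl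

theorem mul_apply (f g : NCPowerSeries σ K) (w : List σ) :
    (f * g) w = ∑ i ∈ Finset.range (w.length + 1), f (w.take i) * g (w.drop i) := rfl

theorem mul_nil (f g : NCPowerSeries σ K) : (f * g) [] = f [] * g [] := by
  simp [mul_apply]

theorem mul_cons (f g : NCPowerSeries σ K) (x : σ) (w : List σ) :
    (f * g) (x :: w) = f [] * g (x :: w) + (f.tail x * g) w := by
  rw [mul_apply, mul_apply, List.length_cons, Finset.sum_range_succ']
  simp [tail, add_comm]

theorem zero_mul' (f : NCPowerSeries σ K) : 0 * f = 0 := by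
  ext w; simp [mul_apply, zero_apply]

theorem add_mul' (f g h : NCPowerSeries σ K) : (f + g) * h = f * h + g * h := by
  ext w; simp [mul_apply, add_apply, add_mul, Finset.sum_add_distrib]

theorem smul_mul' (c : K) (f g : NCPowerSeries σ K) : (c • f) * g = c • (f * g) := by
  ext w; simp [mul_apply, smul_apply, Finset.mul_sum, mul_assoc]

theorem mul_smul' (c : K) (f g : NCPowerSeries σ K) : f * (c • g) = c • (f * g) := by
  ext w; simp [mul_apply, smul_apply, Finset.mul_sum, mul_left_comm]

theorem tail_mul (f g : NCPowerSeries σ K) (x : σ) :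
    (f * g).tail x = f [] • g.tail x + f.tail x * g := by
  ext w; simp only [tail, mul_cons, add_apply, smul_apply]

theorem mul_assoc' (f g h : NCPowerSeries σ K) : f * g * h = f * (g * h) := by
  ext w
  induction w generalizing f with
  | nil => simp [mul_nil, mul_assoc]
  | cons x w ih =>
    rw [mul_cons, mul_cons, mul_cons, mul_nil, tail_mul, add_mul', add_apply, ih, smul_mul',
      smul_apply]
    ring

theorem one_mul' (f : NCPowerSeries σ K) : 1 * f = f := by
  ext w
  cases w with
  | nil => simp [mul_nil, one_nil]
  | cons x w =>
    have h : (1 : NCPowerSeries σ K).tail x = 0 := rfl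
    rw [mul_cons, one_nil, h, zero_mul', zero_apply, one_mul, add_zero]

theorem mul_one' (f : NCPowerSeries σ K) : f * 1 = f := by
  ext w
  induction w generalizing f with
  | nil => simp [mul_nil, one_nil]
  | cons x w ih => rw [mul_cons, ih, one_cons, mul_zero, zero_add]; rfl

instance : Ring (NCPowerSeries σ K) :=
  { (inferInstance : AddCommGroup (NCPowerSeries σ K)),
    (inferInstance : One (NCPowerSeries σ K)),
    (inferInstance : Mul (NCPowerSeries σ K)) with
    zero_mul := zero_mul'
    mul_zero := fun f => by ext w; simp [mul_apply, zero_apply]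
    left_distrib := fun f g h => by
      ext w; simp [mul_apply, add_apply, mul_add, Finset.sum_add_distrib]
    right_distrib := add_mul'
    mul_assoc := mul_assoc'
    one_mul := one_mul'
    mul_one := mul_one' }

instance : Algebra K (NCPowerSeries σ K) := Algebra.ofModule smul_mul' mul_smul'

end Ring

end NCPowerSeries

/-! ### The q-determinant -/

/-- Non-commutative polynomials with complex coefficients in the variables `a i j`, that is, finite
linear combinations of words in these variables. -/
abbrev NCPoly (m : ℕ) : Type := MonoidAlgebra ℂ (FreeMonoid (Fin m × Fin m))

/-- The variable `a i j`. -/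
noncomputable def NCPoly.var {m : ℕ} (i j : Fin m) : NCPoly m :=
  MonoidAlgebra.single (FreeMonoid.of (i, j)) 1

/-- The matrix `(a i j)` of the variables. -/
noncomputable def NCPoly.genMatrix (m : ℕ) : Matrix (Fin m) (Fin m) (NCPoly m) :=
  Matrix.of fun i j => NCPoly.var i j

/-- Substitution of the entries of a matrix `A` for the variables. -/
noncomputable def NCPoly.evalAt {m : ℕ} {R : Type*} [Ring R] [Algebra ℂ R]
    (A : Matrix (Fin m) (Fin m) R) : NCPoly m →ₐ[ℂ] R :=
  MonoidAlgebra.lift ℂ R (FreeMonoid (Fin m × Fin m)) (FreeMonoid.lift fun p => A p.1 p.2)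

/-- The number of inversions of a word `ν`: the number of pairs `p < r` with `ν p > ν r`. -/
def wordInv {m : ℕ} : List (Fin m) → ℕ
  | [] => 0
  | x :: l => l.countP (fun y => y < x) + wordInv l

/-- The weight `q ^ (inv μ - inv l)` of the word `a (l 1) (μ 1) ⋯ a (l r) (μ r)`. -/
noncomputable def qWeight {m : ℕ} (q : ℂ) (w : FreeMonoid (Fin m × Fin m)) : ℂ :=
  q ^ ((wordInv (w.toList.map Prod.snd) : ℤ) - (wordInv (w.toList.map Prod.fst) : ℤ))

/-- Multiply every word of a non-commutative polynomial by its weight. -/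
noncomputable def applyQWeight {m : ℕ} (q : ℂ) (f : NCPoly m) : NCPoly m :=
  f.coeff.sum fun w c => MonoidAlgebra.single w (qWeight q w * c)

/-- The `q`-determinant of a matrix `B` whose entries are polynomials in the variables `a i j`:
expand `∑ σ, sign σ * B (σ 1) 1 * B (σ 2) 2 * ⋯ * B (σ r) r` into words in the variables, and weight
each word by `qWeight`. -/
noncomputable def qDet {m r : ℕ} (q : ℂ) (B : Matrix (Fin r) (Fin r) (NCPoly m)) : NCPoly m :=
  applyQWeight q
    (∑ s : Equiv.Perm (Fin r),
      (Equiv.Perm.sign s : ℤ) • (List.ofFn fun j : Fin r => B (s j) j).prod)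

/-- `det_q (I - A)` for a matrix `A` over a complex algebra: words are taken in the entries of
`A`. -/
noncomputable def qDetOneSub {m : ℕ} {R : Type*} [Ring R] [Algebra ℂ R] (q : ℂ)
    (A : Matrix (Fin m) (Fin m) R) : R :=
  NCPoly.evalAt A (qDet q (1 - NCPoly.genMatrix m))

/-! ### q-Cartier-Foata matrices and the matrix `C^q` -/

/-- The `q`-Cartier-Foata relations between the entries of `A`. -/
structure IsQCartierFoata {m : ℕ} {R : Type*} [Ring R] [Algebra ℂ R] (q : ℂ)
    (A : Matrix (Fin m) (Fin m) R) : Prop where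
  comm_of_lt : ∀ i j k l, i < j → k < l → A j l * A i k = A i k * A j l
  comm_of_gt : ∀ i j k l, i < j → l < k → A j l * A i k = q ^ 2 • (A i k * A j l)
  comm_same : ∀ i j k, i < j → A j k * A i k = q • (A i k * A j k)

/-- The upper left `n × n` block `A₀` of an `(n + k) × (n + k)` matrix `A`. -/
def upperLeft {n k : ℕ} {R : Type*} (A : Matrix (Fin (n + k)) (Fin (n + k)) R) :
    Matrix (Fin n) (Fin n) R :=
  A.submatrix (Fin.castAdd k) (Fin.castAdd k)

/-- The bordered matrix with blocks `I - A₀`, `-a_{*j}`, `-a_{i*}`, `-a_{ij}`, where `A = (a i j)` is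
the `(n + k) × (n + k)` matrix of variables, and `i`, `j` stand for the indices `n + i`, `n + j` of
`A`. -/
noncomputable def borderedMatrix (n k : ℕ) (i j : Fin k) :
    Matrix (Fin (n + 1)) (Fin (n + 1)) (NCPoly (n + k)) :=
  (Matrix.fromBlocks
    (1 - upperLeft (NCPoly.genMatrix (n + k)))
    (Matrix.of fun r (_ : Fin 1) => -NCPoly.var (Fin.castAdd k r) (Fin.natAdd n j))
    (Matrix.of fun (_ : Fin 1) s => -NCPoly.var (Fin.natAdd n i) (Fin.castAdd k s))
    (Matrix.of fun (_ : Fin 1) (_ : Fin 1) => -NCPoly.var (Fin.natAdd n i) (Fin.natAdd n j))).reindex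
      finSumFinEquiv finSumFinEquiv

/-- The matrix `C^q`, with entries minus the inverse of `det_q (I - A₀)` times the `q`-determinant
of the bordered matrix. -/
noncomputable def sylvesterC {n k : ℕ} {R : Type*} [Ring R] [Algebra ℂ R] (q : ℂ)
    (A : Matrix (Fin (n + k)) (Fin (n + k)) R) : Matrix (Fin k) (Fin k) R :=
  Matrix.of fun i j =>
    -(Ring.inverse (qDetOneSub q (upperLeft A)) *
      NCPoly.evalAt A (qDet q (borderedMatrix n k i j)))

/-- The matrix of the images of the variables under an algebra homomorphism from the formal power
series in the non-commuting variables `a i j`. -/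
noncomputable def imageMatrix {m : ℕ} {R : Type*} [Ring R] [Algebra ℂ R]
    (φ : NCPowerSeries (Fin m × Fin m) ℂ →ₐ[ℂ] R) : Matrix (Fin m) (Fin m) R :=
  Matrix.of fun i j => φ (NCPowerSeries.X (i, j))

/-! The proof is a Schur complement computation by column operations. Expanding along the last
column peels off the rightmost factor of each word, and the power of `q` created by that factor
depends only on the rows and columns still to be expanded. Storing this power in the entry
(`qEntry`) turns the `q`-determinant into a plain signed expansion `qMinor`; the identification is
`evalAt_qDet`.

The Cartier-Foata relations say exactly that two such weighted entries may be exchanged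
(`qEntry_mul_qEntry`). Hence `qMinor` is alternating in its columns and vanishes when its first
listed column is repeated (`qMinor_eq_zero`), for any scalar diagonal `e`. A right multiple of one
of the first `n` columns can therefore be added to a later column. If `v` solves `(I - q⁻¹ A₀) v =
A₀₁`, where `A₀₁` is the upper right block, multiples of the entries of `v` clear the top `n` rows,
and the minor factors as `det_q (I - A₀)` times a `q`-minor of the Schur matrix `A₁₁ + q⁻¹ A₁₀ v`
(`qMinor_extend`).

This factorization is used twice. With `e = 1` it factors `det_q (I - A)`. With one extra row and
column and `e = (1, …, 1, 0)` it evaluates the bordered determinants, showing that `C^q` is the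
Schur matrix. The vector `v` comes from a power series of paths, and `det_q (I - A₀)` is invertible
because its constant term is `1`. -/

/-! ### Alternating column expansions and `q`-minors. -/

section ColumnExpansion

variable {ι : Type*} [LinearOrder ι]

/-- The sum over the ways to choose distinct rows from `J`, one for each entry of a list of columns,
by repeated expansion along the head of the list; the entry `g κ J i j` for row `i` and column `j`
may depend on the columns `κ` and the rows `J` still to be expanded. -/
def columnExpansion {κ S : Type*} [Ring S] [Algebra ℂ S]
    (g : List κ → Finset ι → ι → κ → S) : List κ → Finset ι → S
  | [], _ => 1
  | j :: l, J => ∑ i ∈ J, (-1 : ℂ) ^ (J.filter (i < ·)).card •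
      (columnExpansion g l (J.erase i) * g l (J.erase i) i j)

/-- Deleting the smaller row first does not change the count above the larger one, while deleting
the larger row first lowers the count above the smaller one by one. -/
theorem neg_one_pow_card_swap (J : Finset ι) {i l : ι} (hi : i ∈ J) (hl : l ∈ J) (h : i ≠ l) :
    (-1 : ℂ) ^ (J.filter (i < ·)).card * (-1) ^ ((J.erase i).filter (l < ·)).card =
      -((-1) ^ (J.filter (l < ·)).card * (-1) ^ ((J.erase l).filter (i < ·)).card) := by
  wlog hil : i < l generalizing i l
  · rw [this hl hi h.symm (lt_of_le_of_ne (not_lt.mp hil) h.symm), neg_neg]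
  have h1 : (J.erase i).filter (l < ·) = J.filter (l < ·) := by
    rw [Finset.filter_erase, Finset.erase_eq_of_notMem]
    simp [hil.le]
  have h2 : ((J.erase l).filter (i < ·)).card + 1 = (J.filter (i < ·)).card := by
    rw [Finset.filter_erase, Finset.card_erase_add_one]
    simp [hl, hil]
  rw [h1, ← h2]
  ring

/-- The hypothesis `hg` makes the product of the last two factors independent of the order in which
they are chosen, so only the sign of the double expansion changes. -/
theorem columnExpansion_swap {κ S : Type*} [Ring S] [Algebra ℂ S]
    {g : List κ → Finset ι → ι → κ → S}
    (hg : ∀ L J i l j k, i ∉ J → l ∉ J → i ≠ l →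
      g L J l k * g (k :: L) (insert l J) i j = g L J i j * g (j :: L) (insert i J) l k)
    (j k : κ) (L : List κ) (J : Finset ι) :
    columnExpansion g (j :: k :: L) J = -columnExpansion g (k :: j :: L) J := by
  -- Both expansions become sums over ordered pairs of distinct rows; exchanging the pair then
  -- matches them term by term.
  have expand (j k : κ) : columnExpansion g (j :: k :: L) J =
      ∑ p ∈ J.offDiag, ((-1 : ℂ) ^ (J.filter (p.1 < ·)).card *
        (-1) ^ ((J.erase p.1).filter (p.2 < ·)).card) •
        (columnExpansion g L ((J.erase p.1).erase p.2) *
          (g L ((J.erase p.1).erase p.2) p.2 k * g (k :: L) (J.erase p.1) p.1 j)) := by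
    have : J.offDiag = (J.sigma fun i => J.erase i).map
        (Equiv.sigmaEquivProd ι ι).toEmbedding := by
      ext ⟨a, b⟩
      simp [Finset.mem_offDiag, Finset.mem_map_equiv, eq_comm, and_comm]
    rw [this, Finset.sum_map, Finset.sum_sigma]
    simp only [columnExpansion, Finset.sum_mul, Finset.smul_sum]
    refine Finset.sum_congr rfl fun i _ => Finset.sum_congr rfl fun l _ => ?_
    simp only [smul_mul_assoc, smul_smul, mul_assoc, Equiv.sigmaEquivProd, Equiv.coe_fn_mk,
      Equiv.toEmbedding_apply]
    rfl
  rw [expand j k, expand k j, ← Finset.sum_neg_distrib]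
  refine Finset.sum_nbij' Prod.swap Prod.swap ?_ ?_ (fun _ _ => rfl) (fun _ _ => rfl) ?_
  · rintro ⟨i, l⟩ h
    simp only [Finset.mem_offDiag, Prod.fst_swap, Prod.snd_swap] at h ⊢
    exact ⟨h.2.1, h.1, h.2.2.symm⟩
  · rintro ⟨i, l⟩ h
    simp only [Finset.mem_offDiag, Prod.fst_swap, Prod.snd_swap] at h ⊢
    exact ⟨h.2.1, h.1, h.2.2.symm⟩
  rintro ⟨i, l⟩ h
  obtain ⟨hi, hl, hil⟩ := Finset.mem_offDiag.mp h
  simp only [Prod.fst_swap, Prod.snd_swap] at hi hl hil ⊢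
  have h1 := hg L ((J.erase i).erase l) i l j k (by simp) (by simp) hil
  rw [Finset.insert_erase (by simp [hl, hil.symm]), Finset.erase_right_comm,
    Finset.insert_erase (by simp [hi, hil])] at h1
  rw [Finset.erase_right_comm, h1, neg_one_pow_card_swap J hi hl hil, neg_smul]

/-- Exchanging the first two columns either reproduces the expansion with the opposite sign, or puts
the repeated column one level deeper, where induction kills every summand. -/
theorem columnExpansion_eq_zero {κ S : Type*} [Ring S] [Algebra ℂ S]
    {g : List κ → Finset ι → ι → κ → S}
    (hg : ∀ L J i l j k, i ∉ J → l ∉ J → i ≠ l →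
      g L J l k * g (k :: L) (insert l J) i j = g L J i j * g (j :: L) (insert i J) l k)
    {j : κ} {L : List κ} (hj : j ∈ L) (J : Finset ι) :
    columnExpansion g (j :: L) J = 0 := by
  induction L generalizing J with
  | nil => simp at hj
  | cons k L ih =>
    rw [columnExpansion_swap hg]
    by_cases hjk : j = k
    · subst hjk
      have h := columnExpansion_swap hg j j L J
      have h2 : (2 : ℂ) • columnExpansion g (j :: j :: L) J = 0 := by
        rw [two_smul]
        nth_rewrite 1 [h]
        exact neg_add_cancel _
      rw [(smul_eq_zero_iff_right two_ne_zero).mp h2, neg_zero]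
    · have hj' : j ∈ L := by simpa [hjk] using hj
      rw [columnExpansion]
      simp [ih hj']

theorem map_columnExpansion {κ S T : Type*} [Ring S] [Algebra ℂ S] [Ring T] [Algebra ℂ T]
    (f : S →ₐ[ℂ] T) (g : List κ → Finset ι → ι → κ → S) (L : List κ) (J : Finset ι) :
    f (columnExpansion g L J) = columnExpansion (fun L J i j => f (g L J i j)) L J := by
  induction L generalizing J with
  | nil => simp [columnExpansion]
  | cons k L ih => simp [columnExpansion, ih]

/-- The entries `δ i j * e j - A i j` with the powers of `q` that turn `columnExpansion` into the
`q`-determinant. -/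
noncomputable def qEntry {R : Type*} [Ring R] [Algebra ℂ R] (q : ℂ) (e : ι → ℂ)
    (A : Matrix ι ι R) (L : List ι) (J : Finset ι) (i j : ι) : R :=
  (if i = j then e j * q ^ ((L.countP (· < j) : ℤ) - (J.filter (· < j)).card) else 0) • (1 : R) -
    q ^ ((L.countP (j < ·) : ℤ) - (J.filter (i < ·)).card) • A i j

/-- The relations of a `q`-Cartier-Foata matrix in a symmetric form, with exponents. -/
theorem qCartierFoata_comm {m : ℕ} {R : Type*} [Ring R] [Algebra ℂ R] {q : ℂ} (hq : q ≠ 0)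
    {A : Matrix (Fin m) (Fin m) R} (hA : IsQCartierFoata q A) {i l : Fin m} (h : i ≠ l)
    (j k : Fin m) :
    q ^ ((if j < k then 1 else 0 : ℤ) - (if i < l then 1 else 0)) • (A l k * A i j) =
      q ^ ((if k < j then 1 else 0 : ℤ) - (if l < i then 1 else 0)) • (A i j * A l k) := by
  wlog hil : i < l generalizing i l j k
  · exact (this h.symm k j (lt_of_le_of_ne (not_lt.mp hil) h.symm)).symm
  rw [if_pos hil, if_neg hil.le.not_gt]
  rcases lt_trichotomy j k with hjk | rfl | hjk
  · rw [if_pos hjk, if_neg hjk.le.not_gt, hA.comm_of_lt i l j k hil hjk]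
    simp
  · rw [hA.comm_same i l j hil, smul_smul]
    simp [hq]
  · rw [if_pos hjk, if_neg hjk.le.not_gt, hA.comm_of_gt i l j k hil hjk, smul_smul]
    congr 1
    rw [zero_sub, sub_zero, zpow_neg_one, zpow_one]
    field_simp

theorem card_filter_insert {p : ι → Prop} [DecidablePred p] {J : Finset ι} {i : ι} (hi : i ∉ J) :
    (((insert i J).filter p).card : ℤ) = (J.filter p).card + if p i then 1 else 0 := by
  rw [Finset.filter_insert]
  split_ifs
  · rw [Finset.card_insert_of_notMem (by simp [hi])]
    simp
  · simp

/-- Enlarging the lists by one column and one row shifts the exponents precisely by the powers in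
`qCartierFoata_comm`. The powers of `q` on the diagonal are chosen so that products involving a
scalar match too. -/
theorem qEntry_mul_qEntry {m : ℕ} {R : Type*} [Ring R] [Algebra ℂ R] {q : ℂ} (hq : q ≠ 0)
    (e : Fin m → ℂ) {A : Matrix (Fin m) (Fin m) R} (hA : IsQCartierFoata q A)
    (L : List (Fin m)) (J : Finset (Fin m)) (i l j k : Fin m) (hi : i ∉ J) (hl : l ∉ J)
    (h : i ≠ l) :
    qEntry q e A L J l k * qEntry q e A (k :: L) (insert l J) i j =
      qEntry q e A L J i j * qEntry q e A (j :: L) (insert i J) l k := by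
  have hAA := qCartierFoata_comm hq hA h j k
  simp only [qEntry, card_filter_insert hi, card_filter_insert hl, List.countP_cons,
    decide_eq_true_eq, Nat.cast_add, Nat.cast_ite, Nat.cast_one, Nat.cast_zero]
  have e1 : (L.countP (k < ·) - (J.filter (l < ·)).card : ℤ) +
      (L.countP (j < ·) + (if j < k then 1 else 0) -
        ((J.filter (i < ·)).card + if i < l then 1 else 0) : ℤ) =
      ((L.countP (k < ·) - (J.filter (l < ·)).card : ℤ) +
      (L.countP (j < ·) - (J.filter (i < ·)).card)) +
        ((if j < k then 1 else 0 : ℤ) - (if i < l then 1 else 0)) := by ring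
  have e2 : (L.countP (j < ·) - (J.filter (i < ·)).card : ℤ) +
      (L.countP (k < ·) + (if k < j then 1 else 0) -
        ((J.filter (l < ·)).card + if l < i then 1 else 0) : ℤ) =
      ((L.countP (k < ·) - (J.filter (l < ·)).card : ℤ) +
      (L.countP (j < ·) - (J.filter (i < ·)).card)) +
        ((if k < j then 1 else 0 : ℤ) - (if l < i then 1 else 0)) := by ring
  have hAA' := congrArg (fun x => q ^ ((L.countP (k < ·) - (J.filter (l < ·)).card : ℤ) +
      (L.countP (j < ·) - (J.filter (i < ·)).card)) • x) hAA
  simp only [smul_smul, ← zpow_add₀ hq] at hAA'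
  rw [← e1, ← e2] at hAA'
  have diag (a b c d : ℤ) (hab : l = k → i = j → a + b = c + d) :
      (if l = k then e k * q ^ a else 0) * (if i = j then e j * q ^ b else 0) =
        (if i = j then e j * q ^ c else 0) * (if l = k then e k * q ^ d else 0) := by
    split_ifs with h1 h2
    · have := congrArg (q ^ ·) (hab h1 h2)
      simp only [zpow_add₀ hq] at this
      linear_combination e k * e j * this
    all_goals simp
  -- Scalar times variable: for `l = k` the comparison of this index with the row and column of the
  -- variable only moves from the variable's exponent to that of the scalar.
  have mixed (l k : Fin m) (a b c d : ℤ) (hab : l = k → a + b = c + d) :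
      (if l = k then e k * q ^ a else 0) * q ^ b =
        q ^ c * (if l = k then e k * q ^ d else 0) := by
    split_ifs with h1
    · have := congrArg (q ^ ·) (hab h1)
      simp only [zpow_add₀ hq] at this
      linear_combination e k * this
    · simp
  simp only [sub_mul, mul_sub, smul_mul_smul_comm, one_mul, mul_one, ← zpow_add₀ hq]
  rw [hAA', diag _ _ _ _ ?_, mixed l k _ _ _ _ ?_, ← mixed i j _ _ _ _ ?_]
  · abel
  · rintro rfl; ring
  · rintro rfl; ring
  · rintro rfl rfl; ring

theorem map_qEntry {R S : Type*} [Ring R] [Algebra ℂ R] [Ring S] [Algebra ℂ S] (f : R →ₐ[ℂ] S)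
    (q : ℂ) (e : ι → ℂ) (A : Matrix ι ι R) (L : List ι) (J : Finset ι) (i j : ι) :
    f (qEntry q e A L J i j) = qEntry q e (A.map f) L J i j := by
  simp only [qEntry, map_sub, map_smul, map_one, Matrix.map_apply]

/-- The `q`-determinant of `diag e - A` restricted to the rows in `J` and the columns in `L`, where
`L` is listed from last to first. -/
noncomputable def qMinor {R : Type*} [Ring R] [Algebra ℂ R] (q : ℂ) (e : ι → ℂ)
    (A : Matrix ι ι R) (L : List ι) (J : Finset ι) : R :=
  columnExpansion (qEntry q e A) L J

theorem qMinor_nil {R : Type*} [Ring R] [Algebra ℂ R] (q : ℂ) (e : ι → ℂ)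
    (A : Matrix ι ι R) (J : Finset ι) : qMinor q e A [] J = 1 := rfl

theorem qMinor_cons {R : Type*} [Ring R] [Algebra ℂ R] (q : ℂ) (e : ι → ℂ)
    (A : Matrix ι ι R) (j : ι) (L : List ι) (J : Finset ι) : qMinor q e A (j :: L) J =
      ∑ i ∈ J, (-1 : ℂ) ^ (J.filter (i < ·)).card •
        (qMinor q e A L (J.erase i) * qEntry q e A L (J.erase i) i j) := rfl

theorem map_qMinor {R S : Type*} [Ring R] [Algebra ℂ R] [Ring S] [Algebra ℂ S] (f : R →ₐ[ℂ] S)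
    (q : ℂ) (e : ι → ℂ) (A : Matrix ι ι R) (L : List ι) (J : Finset ι) :
    f (qMinor q e A L J) = qMinor q e (A.map f) L J := by
  simp only [qMinor, map_columnExpansion, map_qEntry]

theorem qMinor_eq_zero {m : ℕ} {R : Type*} [Ring R] [Algebra ℂ R] {q : ℂ} (hq : q ≠ 0)
    (e : Fin m → ℂ) {A : Matrix (Fin m) (Fin m) R} (hA : IsQCartierFoata q A) {j : Fin m}
    {L : List (Fin m)} (hj : j ∈ L) (J : Finset (Fin m)) : qMinor q e A (j :: L) J = 0 :=
  columnExpansion_eq_zero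
    (fun L J i l j k hi hl h => qEntry_mul_qEntry hq e hA L J i l j k hi hl h) hj J

theorem card_filter_map_embedding {κ : Type*} [LinearOrder κ] (f : κ ↪o ι) (J : Finset κ)
    (p : ι → Prop) (p' : κ → Prop) [DecidablePred p] [DecidablePred p']
    (h : ∀ x, p (f x) ↔ p' x) :
    ((J.map f.toEmbedding).filter p).card = (J.filter p').card := by
  rw [Finset.filter_map, Finset.card_map]
  congr 1
  ext x
  simp [h]

theorem qMinor_map {κ R : Type*} [LinearOrder κ] [Ring R] [Algebra ℂ R] (q : ℂ) (e : ι → ℂ)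
    (A : Matrix ι ι R) (f : κ ↪o ι) (L : List κ) (J : Finset κ) :
    qMinor q e A (L.map f) (J.map f.toEmbedding) =
      qMinor q (e ∘ f) (A.submatrix f f) L J := by
  induction L generalizing J with
  | nil => rfl
  | cons k L ih =>
    rw [List.map_cons, qMinor_cons, qMinor_cons, Finset.sum_map]
    refine Finset.sum_congr rfl fun i _ => ?_
    have hJ : (J.map f.toEmbedding).erase (f.toEmbedding i) = (J.erase i).map f.toEmbedding :=
      (Finset.map_erase _ _ _).symm
    rw [hJ, ih, card_filter_map_embedding f J _ (i < ·) (by simp)]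
    congr 2
    simp only [qEntry, List.countP_map, Matrix.submatrix_apply]
    rw [card_filter_map_embedding f _ _ (· < k) (by simp),
      card_filter_map_embedding f _ _ (i < ·) (by simp)]
    simp [Function.comp_def]

end ColumnExpansion

/-! ### Column reduction and the Schur factorization. -/

section Factorization

theorem countP_finRange (n : ℕ) (p : Fin n → Prop) [DecidablePred p] :
    (List.finRange n).countP p = (Finset.univ.filter p).card := by
  rw [List.countP_eq_length_filter]
  rfl

/-- All elements of `Fin n`, listed from last to first. -/
def columnsDesc (n : ℕ) : List (Fin n) := (List.finRange n).reverse

theorem countP_columnsDesc (n : ℕ) (p : Fin n → Prop) [DecidablePred p] :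
    (columnsDesc n).countP p = (Finset.univ.filter p).card := by
  rw [columnsDesc, List.countP_reverse, countP_finRange]

theorem length_columnsDesc (n : ℕ) : (columnsDesc n).length = n := by
  simp [columnsDesc]

theorem mem_columnsDesc {n : ℕ} (s : Fin n) : s ∈ columnsDesc n := by
  simp [columnsDesc]

theorem card_filter_lt_int {n : ℕ} (s : Fin n) :
    (((Finset.univ.filter (· < s)).card : ℕ) : ℤ) = s := by
  rw [Finset.filter_gt_eq_Iio, Fin.card_Iio]

theorem card_filter_gt_int {n : ℕ} (s : Fin n) :
    (((Finset.univ.filter (s < ·)).card : ℕ) : ℤ) = n - 1 - s := by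
  have := s.2
  rw [Finset.filter_lt_eq_Ioi, Fin.card_Ioi]
  omega

/-- All counts are strict comparisons with `i` (for the scalar part, only when `i = j`), so the row
`i` itself never contributes. -/
theorem qEntry_erase {ι R : Type*} [LinearOrder ι] [Ring R] [Algebra ℂ R] (q : ℂ) (e : ι → ℂ)
    (A : Matrix ι ι R) (L : List ι) (J : Finset ι) (i j : ι) :
    qEntry q e A L (J.erase i) i j = qEntry q e A L J i j := by
  have h1 : (J.erase i).filter (i < ·) = J.filter (i < ·) := by
    rw [Finset.filter_erase, Finset.erase_eq_of_notMem (by simp)]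
  have h2 (h : i = j) : (J.erase i).filter (· < j) = J.filter (· < j) := by
    rw [Finset.filter_erase, Finset.erase_eq_of_notMem (by simp [h])]
  rw [qEntry, qEntry, h1]
  split_ifs with h
  · rw [h2 h]
  · rfl

variable {n k : ℕ}

/-- The columns `n + j`, for `j` in `L`, put in front of the columns `n - 1, …, 0`. -/
def extendColumns (n : ℕ) {k : ℕ} (L : List (Fin k)) : List (Fin (n + k)) :=
  L.map (Fin.natAdd n) ++ (columnsDesc n).map (Fin.castAdd k)

/-- The rows `n + i`, for `i` in `J`, together with the rows `0, …, n - 1`. -/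
def extendRows (n : ℕ) {k : ℕ} (J : Finset (Fin k)) : Finset (Fin (n + k)) :=
  Finset.univ.map (Fin.castAddOrderEmb k).toEmbedding ∪
    J.map (Fin.natAddOrderEmb n).toEmbedding

theorem castAdd_mem_extendRows (J : Finset (Fin k)) (s : Fin n) :
    Fin.castAdd k s ∈ extendRows n J := by
  simp only [extendRows, Finset.mem_union, Finset.mem_map]
  exact Or.inl ⟨s, Finset.mem_univ _, rfl⟩

theorem natAdd_mem_extendRows {J : Finset (Fin k)} {i : Fin k} :
    Fin.natAdd n i ∈ extendRows n J ↔ i ∈ J := by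
  simp only [extendRows, Finset.mem_union, Finset.mem_map]
  constructor
  · rintro (⟨a, -, h⟩ | ⟨a, ha, h⟩)
    · have h' : (a : ℕ) = n + i := congrArg Fin.val h
      omega
    · obtain rfl : a = i := (Fin.natAddOrderEmb n).injective h
      exact ha
  · exact fun h => Or.inr ⟨i, h, rfl⟩

theorem erase_extendRows (J : Finset (Fin k)) (i : Fin k) :
    (extendRows n J).erase (Fin.natAdd n i) = extendRows n (J.erase i) := by
  ext x
  refine Fin.addCases (fun s => ?_) (fun j => ?_) x
  · have : Fin.castAdd k s ≠ Fin.natAdd n i := by simp [Fin.ext_iff]; omega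
    simp [castAdd_mem_extendRows, this]
  · simp [natAdd_mem_extendRows]

theorem sum_extendRows {M : Type*} [AddCommMonoid M] (J : Finset (Fin k)) (f : Fin (n + k) → M) :
    ∑ i ∈ extendRows n J, f i =
      ∑ s : Fin n, f (Fin.castAdd k s) + ∑ i ∈ J, f (Fin.natAdd n i) := by
  rw [extendRows, Finset.sum_union, Finset.sum_map, Finset.sum_map]
  · rfl
  · rw [Finset.disjoint_left]
    simp only [Finset.mem_map]
    rintro _ ⟨s, -, rfl⟩ ⟨i, -, h⟩
    have h' : n + (i : ℕ) = s := congrArg Fin.val h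
    omega

theorem card_filter_extendRows (J : Finset (Fin k)) (p : Fin (n + k) → Prop) [DecidablePred p] :
    ((extendRows n J).filter p).card =
      (Finset.univ.filter fun s : Fin n => p (Fin.castAdd k s)).card +
        (J.filter fun i => p (Fin.natAdd n i)).card := by
  simp only [Finset.card_filter, sum_extendRows]

theorem countP_extendColumns (L : List (Fin k)) (p : Fin (n + k) → Prop) [DecidablePred p] :
    (extendColumns n L).countP p =
      (Finset.univ.filter fun s : Fin n => p (Fin.castAdd k s)).card +
        L.countP fun i => p (Fin.natAdd n i) := by
  rw [extendColumns, List.countP_append, List.countP_map, List.countP_map, ← countP_columnsDesc,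
    add_comm]
  rfl

theorem castAdd_lt_natAdd (s : Fin n) (j : Fin k) : Fin.castAdd k s < Fin.natAdd n j := by
  simp only [Fin.lt_def, Fin.val_castAdd, Fin.val_natAdd]
  omega

theorem castAdd_lt_castAdd (s t : Fin n) : Fin.castAdd k s < Fin.castAdd k t ↔ s < t := Iff.rfl

theorem natAdd_lt_natAdd (i j : Fin k) : Fin.natAdd n i < Fin.natAdd n j ↔ i < j := by
  simp

variable {R : Type*} [Ring R] [Algebra ℂ R]

/-- The matrix `A₁₁ + q⁻¹ A₁₀ v` of size `k` made from the blocks of `A`. -/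
noncomputable def schurMatrix (q : ℂ) (A : Matrix (Fin (n + k)) (Fin (n + k)) R)
    (v : Matrix (Fin n) (Fin k) R) : Matrix (Fin k) (Fin k) R :=
  Matrix.of fun i j => A (Fin.natAdd n i) (Fin.natAdd n j) +
    q⁻¹ • ∑ s, A (Fin.natAdd n i) (Fin.castAdd k s) * v s j

/-- A combination of the first `n` columns is added to the column `n + j` before expanding along it.
The top rows of the new column vanish by `hv`, and the others are entries of the Schur matrix, so
induction on `L` applies. Only the relations in `A` are needed, none between entries of the Schur
matrix. -/
theorem qMinor_extend {q : ℂ} (hq : q ≠ 0) {e : Fin (n + k) → ℂ}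
    (he : ∀ s, e (Fin.castAdd k s) = 1) {A : Matrix (Fin (n + k)) (Fin (n + k)) R}
    (hA : IsQCartierFoata q A) {v : Matrix (Fin n) (Fin k) R}
    (hv : ∀ s j, v s j - q⁻¹ • ∑ t, A (Fin.castAdd k s) (Fin.castAdd k t) * v t j =
      A (Fin.castAdd k s) (Fin.natAdd n j))
    (L : List (Fin k)) (J : Finset (Fin k)) (hLJ : J.card = L.length) :
    qMinor q e A (extendColumns n L) (extendRows n J) =
      qMinor q e A (extendColumns n ([] : List (Fin k))) (extendRows n ∅) *
        qMinor q (fun j => e (Fin.natAdd n j)) (schurMatrix q A v) L J := by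
  induction L generalizing J with
  | nil =>
    obtain rfl : J = ∅ := by simpa using hLJ
    rw [qMinor_nil q _ (schurMatrix q A v), mul_one]
  | cons j L ih =>
    rw [List.length_cons] at hLJ
    have hcons (x : Fin (n + k)) := qMinor_cons q e A x (extendColumns n L) (extendRows n J)
    have hzero (s : Fin n) :
        qMinor q e A (Fin.castAdd k s :: extendColumns n L) (extendRows n J) = 0 := by
      refine qMinor_eq_zero hq e hA ?_ _
      simp [extendColumns, mem_columnsDesc]
    -- This is the power of `q` carried by the entry in row `s` of the column `n + j`.
    set c : Fin n → ℂ := fun s => q ^ ((L.countP (j < ·) : ℤ) - n - L.length + s) with hc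
    have hexp : qMinor q e A (extendColumns n (j :: L)) (extendRows n J) =
        ∑ i ∈ extendRows n J, (-1 : ℂ) ^ ((extendRows n J).filter (i < ·)).card •
          (qMinor q e A (extendColumns n L) ((extendRows n J).erase i) *
            (qEntry q e A (extendColumns n L) ((extendRows n J).erase i) i (Fin.natAdd n j) +
              ∑ s, qEntry q e A (extendColumns n L) ((extendRows n J).erase i) i
                (Fin.castAdd k s) * (c s • v s j))) := by
      -- The added minors have a repeated column, so each is zero. Their coefficients stand on the
      -- right, next to the entry of the expanded column.
      have h0 : qMinor q e A (extendColumns n (j :: L)) (extendRows n J) =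
          qMinor q e A (Fin.natAdd n j :: extendColumns n L) (extendRows n J) +
          ∑ s, qMinor q e A (Fin.castAdd k s :: extendColumns n L) (extendRows n J) *
            (c s • v s j) := by
        simp only [hzero, zero_mul, Finset.sum_const_zero, add_zero]
        rfl
      rw [h0]
      simp only [hcons, Finset.sum_mul]
      rw [Finset.sum_comm, ← Finset.sum_add_distrib]
      refine Finset.sum_congr rfl fun i _ => ?_
      rw [mul_add, smul_add, Finset.mul_sum, Finset.smul_sum]
      simp only [smul_mul_assoc, mul_assoc]
    have hd : decide True = true := rfl
    have hd' : decide False = false := rfl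
    rw [hexp, sum_extendRows, Finset.sum_eq_zero, zero_add, qMinor_cons, Finset.mul_sum]
    · refine Finset.sum_congr rfl fun i hi => ?_
      have hcard : (J.erase i).card = L.length := by
        rw [Finset.card_erase_of_mem hi]; omega
      rw [erase_extendRows, ih _ hcard, card_filter_extendRows, mul_smul_comm, mul_assoc]
      have h1 : (Finset.univ.filter fun s : Fin n => Fin.natAdd n i < Fin.castAdd k s) = ∅ := by
        simp [(castAdd_lt_natAdd _ _).le]
      simp only [h1, natAdd_lt_natAdd, Finset.card_empty, zero_add]
      congr 3
      have hne (s : Fin n) : Fin.natAdd n i ≠ Fin.castAdd k s := (castAdd_lt_natAdd s i).ne'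
      have hnot (s : Fin n) (j : Fin k) : ¬ Fin.natAdd n j < Fin.castAdd k s :=
        (castAdd_lt_natAdd s j).le.not_gt
      simp only [qEntry, schurMatrix, Matrix.of_apply, card_filter_extendRows,
        countP_extendColumns, natAdd_lt_natAdd, castAdd_lt_natAdd, castAdd_lt_castAdd, hnot, hne,
        Nat.cast_add, card_filter_lt_int, card_filter_gt_int, Finset.filter_false,
        Finset.filter_true, Finset.card_empty, Fin.natAdd_inj, add_sub_add_left_eq_sub,
        Nat.cast_zero, zero_add, if_false, zero_smul, zero_sub, smul_add, smul_smul,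
        neg_mul, smul_mul_smul_comm, Finset.sum_neg_distrib, Finset.smul_sum]
      -- After the factor `c s`, every correction carries the power of the entry in column `n + j`,
      -- times `q⁻¹`: this is the `q⁻¹` of `schurMatrix`.
      have hs (s : Fin n) : q ^ ((n - 1 - s : ℤ) + L.length - ((J.erase i).filter (i < ·)).card) *
          c s = q ^ ((L.countP (j < ·) : ℤ) - ((J.erase i).filter (i < ·)).card) * q⁻¹ := by
        rw [hc, ← zpow_add₀ hq, ← zpow_sub_one₀ hq]
        congr 1
        ring
      simp only [hd, List.countP_true, hs]
      abel
    -- Top rows: the modified entry is a multiple of the equation `hv` and so vanishes.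
    · intro i _
      rw [qEntry_erase]
      simp only [qEntry_erase]
      -- The `- 1` in the exponent arises because `J` has one more row than `L` has columns.
      have hdiag (s : Fin n) :
          qEntry q e A (extendColumns n L) (extendRows n J) (Fin.castAdd k i) (Fin.castAdd k s) =
            (if i = s then (1 : ℂ) else 0) • (1 : R) -
              q ^ ((i : ℤ) - s - 1) • A (Fin.castAdd k i) (Fin.castAdd k s) := by
        have hlt (t : Fin n) (l : Fin k) : ¬ Fin.natAdd n l < Fin.castAdd k t :=
          (castAdd_lt_natAdd t l).le.not_gt
        simp only [qEntry, card_filter_extendRows, countP_extendColumns, castAdd_lt_natAdd, hlt,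
          castAdd_lt_castAdd, Nat.cast_add, card_filter_gt_int, card_filter_lt_int, he,
          Finset.filter_true, Finset.filter_false, Finset.card_empty, hd, hd', List.countP_true,
          List.countP_false, hLJ, (Fin.castAdd_injective n k).eq_iff]
        congr 3
        · simp
        · push_cast
          ring
      have hoff :
          qEntry q e A (extendColumns n L) (extendRows n J) (Fin.castAdd k i) (Fin.natAdd n j) =
            -(c i • A (Fin.castAdd k i) (Fin.natAdd n j)) := by
        have hne : Fin.castAdd k i ≠ Fin.natAdd n j := (castAdd_lt_natAdd i j).ne
        have hlt (t : Fin n) (l : Fin k) : ¬ Fin.natAdd n l < Fin.castAdd k t :=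
          (castAdd_lt_natAdd t l).le.not_gt
        simp only [qEntry, card_filter_extendRows, countP_extendColumns, castAdd_lt_natAdd, hlt,
          castAdd_lt_castAdd, natAdd_lt_natAdd, Nat.cast_add, card_filter_gt_int, hne, if_false,
          Finset.filter_true, Finset.filter_false, Finset.card_empty, hLJ, zero_smul, zero_sub]
        rw [hc]
        congr 3
        push_cast
        ring
      have hs (s : Fin n) : q ^ ((i : ℤ) - s - 1) * c s = c i * q⁻¹ := by
        rw [hc, ← zpow_add₀ hq, ← zpow_sub_one₀ hq]
        congr 1
        ring
      simp only [hdiag, hoff, ← hv i j, sub_mul, smul_mul_smul_comm, one_mul, hs,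
        Finset.sum_sub_distrib, ite_mul, zero_mul, ite_smul, zero_smul, Finset.sum_ite_eq,
        Finset.mem_univ, if_true, smul_sub, Finset.smul_sum, smul_smul]
      simp

end Factorization

/-! ### The `q`-determinant as a `q`-minor. -/

section Relation

/-- The determinant of a matrix with non-commuting entries, the factors of each product being
ordered by columns. -/
def columnDet {r : ℕ} {S : Type*} [Ring S] (B : Matrix (Fin r) (Fin r) S) : S :=
  ∑ s : Equiv.Perm (Fin r), (Equiv.Perm.sign s : ℤ) • (List.ofFn fun j : Fin r => B (s j) j).prod

theorem det_of_perm {r : ℕ} (s : Equiv.Perm (Fin r)) :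
    (Matrix.of fun a b => if a = s b then (1 : ℤ) else 0).det = Equiv.Perm.sign s := by
  have h := Matrix.det_permutation (R := ℤ) s⁻¹
  rw [Equiv.Perm.sign_inv] at h
  rw [Int.cast_id] at h
  rw [← h]
  congr 1
  ext a b
  simp [Equiv.Perm.permMatrix, Equiv.toPEquiv_apply, PEquiv.toMatrix_apply, Equiv.symm_apply_eq]

/-- The permutation that sends the last element to `i` and the other elements as `t` does, up to the
order isomorphisms with `Fin r`. -/
def permSnoc {r : ℕ} (i : Fin (r + 1)) (t : Equiv.Perm (Fin r)) : Equiv.Perm (Fin (r + 1)) :=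
  (finSuccEquiv' (Fin.last r)).trans (t.optionCongr.trans (finSuccEquiv' i).symm)

theorem permSnoc_last {r : ℕ} (i : Fin (r + 1)) (t : Equiv.Perm (Fin r)) :
    permSnoc i t (Fin.last r) = i := by
  simp [permSnoc]

theorem permSnoc_castSucc {r : ℕ} (i : Fin (r + 1)) (t : Equiv.Perm (Fin r)) (j : Fin r) :
    permSnoc i t j.castSucc = i.succAbove (t j) := by
  rw [← Fin.succAbove_last_apply]
  simp only [permSnoc, Equiv.trans_apply, finSuccEquiv'_succAbove]
  simp

/-- Read off from the Laplace expansion of a permutation matrix along its last column, which has a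
single nonzero entry. -/
theorem sign_permSnoc {r : ℕ} (i : Fin (r + 1)) (t : Equiv.Perm (Fin r)) :
    (Equiv.Perm.sign (permSnoc i t) : ℤ) = (-1) ^ (r - i : ℕ) * Equiv.Perm.sign t := by
  rw [← det_of_perm, Matrix.det_succ_column _ (Fin.last r), Finset.sum_eq_single i, ← det_of_perm t]
  · simp only [Matrix.of_apply, permSnoc_last, if_true, mul_one]
    congr 1
    · have h : (i : ℕ) + (Fin.last r : Fin (r + 1)) = (r - i) + 2 * i := by
        have := i.2
        simp only [Fin.val_last]
        omega
      rw [h, pow_add, pow_mul]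
      simp
    · congr 1
      ext a b
      simp [permSnoc_castSucc]
  · intro b _ hb
    simp [permSnoc_last, hb]
  · simp

theorem permSnoc_bijective (r : ℕ) :
    Function.Bijective fun p : Fin (r + 1) × Equiv.Perm (Fin r) => permSnoc p.1 p.2 := by
  rw [Fintype.bijective_iff_injective_and_card]
  constructor
  · rintro ⟨i, t⟩ ⟨i', t'⟩ h
    have h' (x) : permSnoc i t x = permSnoc i' t' x := congrArg (fun s => s x) h
    have hi := h' (Fin.last r)
    rw [permSnoc_last, permSnoc_last] at hi
    subst hi
    congr 1
    ext j
    have := h' j.castSucc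
    rw [permSnoc_castSucc, permSnoc_castSucc] at this
    rw [Fin.succAbove_right_injective this]
  · simp [Fintype.card_perm, Nat.factorial_succ]

theorem columnDet_succ {r : ℕ} {S : Type*} [Ring S] [Algebra ℂ S]
    (B : Matrix (Fin (r + 1)) (Fin (r + 1)) S) :
    columnDet B = ∑ i : Fin (r + 1), (-1 : ℂ) ^ (r - i : ℕ) •
      (columnDet (Matrix.of fun a b => B (i.succAbove a) b.castSucc) * B i (Fin.last r)) := by
  rw [columnDet, ← (permSnoc_bijective r).sum_comp fun s => (Equiv.Perm.sign s : ℤ) •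
    (List.ofFn fun j : Fin (r + 1) => B (s j) j).prod, Fintype.sum_prod_type]
  refine Finset.sum_congr rfl fun i _ => ?_
  rw [columnDet, Finset.sum_mul, Finset.smul_sum]
  refine Finset.sum_congr rfl fun t _ => ?_
  rw [List.ofFn_succ', List.concat_eq_append, List.prod_append, sign_permSnoc, mul_smul]
  simp only [permSnoc_castSucc, permSnoc_last, List.prod_singleton, Matrix.of_apply, smul_mul_assoc]
  rw [← Int.cast_smul_eq_zsmul ℂ]
  simp

theorem columnExpansion_eq_columnDet {ι κ S : Type*} [LinearOrder ι] [Ring S] [Algebra ℂ S]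
    (B : ι → κ → S) {r : ℕ} (f : Fin r ↪o ι) (c : Fin r → κ) :
    columnExpansion (fun _ _ => B) (List.ofFn c).reverse (Finset.univ.map f.toEmbedding) =
      columnDet (Matrix.of fun a b => B (f a) (c b)) := by
  induction r with
  | zero => simp [columnExpansion, columnDet]
  | succ r ih =>
    rw [List.ofFn_succ', List.concat_eq_append, List.reverse_append, List.reverse_singleton,
      List.singleton_append, columnExpansion, Finset.sum_map, columnDet_succ]
    refine Finset.sum_congr rfl fun i _ => ?_
    have h1 : (Finset.univ.map f.toEmbedding).erase (f.toEmbedding i) =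
        Finset.univ.map ((Fin.succAboveOrderEmb i).trans f).toEmbedding := by
      rw [← Finset.map_erase]
      ext x
      simp only [Finset.mem_map, Finset.mem_erase, Finset.mem_univ, and_true, true_and]
      constructor
      · rintro ⟨a, ha, rfl⟩
        obtain ⟨b, rfl⟩ := Fin.exists_succAbove_eq ha
        exact ⟨b, rfl⟩
      · rintro ⟨b, rfl⟩
        exact ⟨i.succAbove b, Fin.succAbove_ne i b, rfl⟩
    rw [h1, ih, card_filter_map_embedding f _ _ (i < ·) (by simp), Finset.filter_lt_eq_Ioi,
      Fin.card_Ioi]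
    rfl

theorem wordInv_concat {m : ℕ} (l : List (Fin m)) (x : Fin m) :
    wordInv (l ++ [x]) = wordInv l + l.countP (x < ·) := by
  induction l with
  | nil => simp [wordInv]
  | cons y l ih =>
    simp only [List.cons_append, wordInv, ih, List.countP_append, List.countP_cons, List.countP_nil]
    omega

variable {m : ℕ}

theorem applyQWeight_single (q : ℂ) (w : FreeMonoid (Fin m × Fin m)) (c : ℂ) :
    applyQWeight q (MonoidAlgebra.single w c) = MonoidAlgebra.single w (qWeight q w * c) := by
  simp [applyQWeight]

theorem applyQWeight_add (q : ℂ) (f g : NCPoly m) :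
    applyQWeight q (f + g) = applyQWeight q f + applyQWeight q g := by
  rw [applyQWeight, MonoidAlgebra.coeff_add, Finsupp.sum_add_index'] <;>
    simp [applyQWeight, mul_add]

theorem applyQWeight_smul (q c : ℂ) (f : NCPoly m) :
    applyQWeight q (c • f) = c • applyQWeight q f := by
  rw [applyQWeight, MonoidAlgebra.coeff_smul, Finsupp.sum_smul_index', applyQWeight,
    Finsupp.smul_sum]
  · simp [mul_left_comm]
  · simp

/-- `applyQWeight` as a linear map. -/
noncomputable def applyQWeightHom (m : ℕ) (q : ℂ) : NCPoly m →ₗ[ℂ] NCPoly m where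
  toFun := applyQWeight q
  map_add' := applyQWeight_add q
  map_smul' := applyQWeight_smul q

/-- The automorphism that multiplies the variable `a l k` by a power of `q` which tells whether
`k > j` and whether `l > i`. -/
noncomputable def twist (q : ℂ) (i j : Fin m) : NCPoly m →ₐ[ℂ] NCPoly m :=
  NCPoly.evalAt (Matrix.of fun l k =>
    q ^ ((if j < k then 1 else 0 : ℤ) - if i < l then 1 else 0) • NCPoly.var l k)

theorem evalAt_var {R : Type*} [Ring R] [Algebra ℂ R] (A : Matrix (Fin m) (Fin m) R)
    (i j : Fin m) : NCPoly.evalAt A (NCPoly.var i j) = A i j := by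
  simp [NCPoly.evalAt, NCPoly.var]

theorem twist_single {q : ℂ} (hq : q ≠ 0) (i j : Fin m) (w : FreeMonoid (Fin m × Fin m)) :
    twist q i j (MonoidAlgebra.single w 1) =
      q ^ (((w.toList.map Prod.snd).countP (j < ·) : ℤ) -
        (w.toList.map Prod.fst).countP (i < ·)) • MonoidAlgebra.single w 1 := by
  induction w using FreeMonoid.inductionOn' with
  | one =>
    have : (MonoidAlgebra.single 1 1 : NCPoly m) = 1 := rfl
    rw [this, map_one]; simp
  | of_mul p w ih =>
    have : (MonoidAlgebra.single (FreeMonoid.of p * w) 1 : NCPoly m) =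
        NCPoly.var p.1 p.2 * MonoidAlgebra.single w 1 := by
      simp [NCPoly.var, MonoidAlgebra.single_mul_single]
    rw [this, map_mul, ih, twist, evalAt_var, Matrix.of_apply, smul_mul_smul_comm, ← zpow_add₀ hq]
    congr 2
    simp only [FreeMonoid.toList_mul, FreeMonoid.toList_of, List.singleton_append, List.map_cons,
      List.countP_cons, decide_eq_true_eq]
    push_cast
    ring

/-- Appending a letter creates one inversion for each earlier larger index. This contribution is
multiplicative over the earlier letters, so an algebra homomorphism records it. -/
theorem applyQWeight_mul_var {q : ℂ} (hq : q ≠ 0) (p : NCPoly m) (i j : Fin m) :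
    applyQWeight q (p * NCPoly.var i j) = applyQWeight q (twist q i j p) * NCPoly.var i j := by
  induction p using MonoidAlgebra.induction_linear with
  | zero => simp [applyQWeight]
  | add f g hf hg => rw [add_mul, applyQWeight_add, hf, hg, map_add, applyQWeight_add, add_mul]
  | single w c =>
    have : (MonoidAlgebra.single w c : NCPoly m) = c • MonoidAlgebra.single w 1 := by simp
    rw [this, map_smul, twist_single hq, smul_smul, applyQWeight_smul, smul_mul_assoc,
      smul_mul_assoc, applyQWeight_smul, mul_smul, NCPoly.var, MonoidAlgebra.single_mul_single,
      applyQWeight_single, applyQWeight_single, MonoidAlgebra.single_mul_single, MonoidAlgebra.smul_single]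
    simp only [MonoidAlgebra.smul_single', mul_one, smul_eq_mul]
    simp only [qWeight, ← zpow_add₀ hq, FreeMonoid.toList_mul, FreeMonoid.toList_of,
      List.map_append, List.map_cons, List.map_nil, wordInv_concat]
    congr 3
    push_cast
    ring

/-- The entries of `diag e - (a (f i) (g j))` for the matrix `a` of variables. -/
noncomputable def diagSubVar {r : ℕ} (e : Fin r → ℂ) (f g : Fin r ↪o Fin m) (i j : Fin r) :
    NCPoly m :=
  (if i = j then e j else 0) • (1 : NCPoly m) - NCPoly.var (f i) (g j)

theorem card_filter_erase_add {ι : Type*} [DecidableEq ι] {p : ι → Prop} [DecidablePred p]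
    {J : Finset ι} {i : ι} (hi : i ∈ J) :
    (((J.erase i).filter p).card : ℤ) + (if p i then 1 else 0) = (J.filter p).card := by
  rw [← Finset.insert_erase hi, Finset.filter_insert, Finset.erase_insert (by simp)]
  split_ifs
  · rw [Finset.card_insert_of_notMem (by simp)]
    simp
  · simp

/-- Scalars on the diagonal supply no letters, so `twist` alone would not act by a single power.
Changing `e` to `e'` gives each scalar the power that a variable in its place would receive. -/
theorem twist_columnExpansion {q : ℂ} (hq : q ≠ 0) {r : ℕ} (f g : Fin r ↪o Fin m) (i j : Fin r)
    {e e' : Fin r → ℂ}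
    (he : ∀ x, e' x = e x * q ^ ((if j < x then 1 else 0 : ℤ) - if i < x then 1 else 0))
    (L : List (Fin r)) (J : Finset (Fin r)) (hLJ : J.card = L.length) :
    twist q (f i) (g j) (columnExpansion (fun _ _ => diagSubVar e' f g) L J) =
      q ^ ((L.countP (j < ·) : ℤ) - (J.filter (i < ·)).card) •
        columnExpansion (fun _ _ => diagSubVar e f g) L J := by
  induction L generalizing J with
  | nil =>
    obtain rfl : J = ∅ := by simpa using hLJ
    simp [columnExpansion]
  | cons k L ih =>
    rw [List.length_cons] at hLJ
    rw [columnExpansion, map_sum, columnExpansion, Finset.smul_sum]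
    refine Finset.sum_congr rfl fun l hl => ?_
    have hcard : (J.erase l).card = L.length := by
      rw [Finset.card_erase_of_mem hl]; omega
    have hentry : twist q (f i) (g j) (diagSubVar e' f g l k) =
        q ^ ((if j < k then 1 else 0 : ℤ) - if i < l then 1 else 0) • diagSubVar e f g l k := by
      simp only [diagSubVar, map_sub, map_smul, map_one, twist, evalAt_var, Matrix.of_apply,
        f.lt_iff_lt, g.lt_iff_lt, smul_sub, smul_smul]
      congr 2
      by_cases h : l = k
      · rw [if_pos h, if_pos h, he, h, mul_comm]
      · rw [if_neg h, if_neg h, mul_zero]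
    rw [map_smul, map_mul, ih _ hcard, hentry, smul_mul_smul_comm, ← zpow_add₀ hq, smul_comm,
      ← card_filter_erase_add hl, List.countP_cons]
    congr 2
    simp only [decide_eq_true_eq]
    push_cast
    ring

/-- Peeling off last factors keeps changing the diagonal. The hypothesis on `e'` records the
accumulated change; its exponent is zero when all rows and columns are present. -/
theorem applyQWeight_columnExpansion {q : ℂ} (hq : q ≠ 0) {r : ℕ} (f g : Fin r ↪o Fin m)
    {e e' : Fin r → ℂ} (L : List (Fin r)) (J : Finset (Fin r)) (hLJ : J.card = L.length)
    (he : ∀ x, e' x = e x * q ^ ((L.countP (· < x) : ℤ) - (J.filter (· < x)).card)) :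
    applyQWeightHom m q (columnExpansion (fun _ _ => diagSubVar e' f g) L J) =
      qMinor q e (Matrix.of fun a b => NCPoly.var (f a) (g b)) L J := by
  induction L generalizing J e' with
  | nil =>
    simp only [columnExpansion, qMinor_nil]
    change applyQWeight q (MonoidAlgebra.single 1 1) = MonoidAlgebra.single 1 1
    rw [applyQWeight_single]
    simp [qWeight, wordInv]
  | cons j L ih =>
    rw [List.length_cons] at hLJ
    rw [columnExpansion, map_sum, qMinor_cons]
    refine Finset.sum_congr rfl fun i hi => ?_
    have hcard : (J.erase i).card = L.length := by
      rw [Finset.card_erase_of_mem hi]; omega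
    rw [map_smul]
    congr 1
    -- The diagonal required by the induction hypothesis once row `i` and column `j` are gone; it
    -- differs from `e'` exactly by the effect of `twist`.
    set e₀ : Fin r → ℂ :=
      fun x => e x * q ^ ((L.countP (· < x) : ℤ) - ((J.erase i).filter (· < x)).card) with he₀
    have he' (x) : e' x = e₀ x * q ^ ((if j < x then 1 else 0 : ℤ) - if i < x then 1 else 0) := by
      rw [he, he₀, mul_assoc, ← zpow_add₀ hq, ← card_filter_erase_add hi, List.countP_cons]
      congr 2
      simp only [decide_eq_true_eq]
      push_cast
      ring
    have hvar : applyQWeightHom m q (columnExpansion (fun _ _ => diagSubVar e' f g) L (J.erase i) *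
        NCPoly.var (f i) (g j)) = q ^ ((L.countP (j < ·) : ℤ) - ((J.erase i).filter (i < ·)).card) •
        (qMinor q e (Matrix.of fun a b => NCPoly.var (f a) (g b)) L (J.erase i) *
          NCPoly.var (f i) (g j)) := by
      rw [← ih (J.erase i) hcard (e' := e₀) (fun x => rfl)]
      change applyQWeight q _ = _ • (applyQWeight q _ * _)
      rw [applyQWeight_mul_var hq, twist_columnExpansion hq f g i j he' _ _ hcard,
        applyQWeight_smul, smul_mul_assoc]
    simp only [qEntry, Matrix.of_apply, mul_sub, mul_smul_comm, mul_one, ← hvar]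
    conv_lhs => rw [diagSubVar]
    rw [mul_sub, map_sub, mul_smul_comm, mul_one, map_smul]
    congr 1
    split_ifs with h
    · subst h
      have hee : e' = e₀ := by
        ext x
        rw [he', sub_self, zpow_zero, mul_one]
      rw [ih (J.erase i) hcard (e' := e') (fun x => by rw [hee]), hee]
    · simp

theorem evalAt_qDet {q : ℂ} (hq : q ≠ 0) {r : ℕ} (f g : Fin r ↪o Fin m) (e : Fin r → ℂ)
    {R : Type*} [Ring R] [Algebra ℂ R] (A : Matrix (Fin m) (Fin m) R) :
    NCPoly.evalAt A (qDet q (Matrix.of (diagSubVar e f g))) =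
      qMinor q e (A.submatrix f g) (columnsDesc r) Finset.univ := by
  have h := columnExpansion_eq_columnDet (diagSubVar e f g) (RelEmbedding.refl (α := Fin r) (· ≤ ·))
    (fun j => j)
  have hid : (Finset.univ : Finset (Fin r)).map (RelEmbedding.refl (· ≤ ·)).toEmbedding =
    Finset.univ := Finset.map_refl
  have hcols : (List.ofFn fun j : Fin r => j).reverse = columnsDesc r := by
    rw [columnsDesc, ← List.ofFn_id]
    rfl
  rw [hid, hcols] at h
  change NCPoly.evalAt A (applyQWeightHom m q (columnDet (Matrix.of (diagSubVar e f g)))) = _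
  have h' := applyQWeight_columnExpansion hq f g (e := e) (e' := e) (columnsDesc r) Finset.univ
    (by simp [length_columnsDesc]) (fun x => by simp [countP_columnsDesc])
  rw [h] at h'
  refine (congrArg _ h').trans ?_
  rw [map_qMinor]
  congr 1
  ext a b
  simp [evalAt_var]

theorem qDetOneSub_eq_qMinor {q : ℂ} (hq : q ≠ 0) {R : Type*} [Ring R] [Algebra ℂ R]
    (A : Matrix (Fin m) (Fin m) R) :
    qDetOneSub q A = qMinor q (fun _ => 1) A (columnsDesc m) Finset.univ := by
  have h := evalAt_qDet hq (RelEmbedding.refl (α := Fin m) (· ≤ ·)) (RelEmbedding.refl (α := Fin m) (· ≤ ·))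
    (fun _ => 1) A
  rw [qDetOneSub]
  convert h using 3
  · ext i j
    simp [diagSubVar, Matrix.one_apply, NCPoly.genMatrix]
  · rfl

end Relation

/-! ### Units and path series in the power series ring. -/

namespace NCPowerSeries

variable {σ K : Type*} [CommRing K]

theorem sum_apply {ι : Type*} (s : Finset ι) (f : ι → NCPowerSeries σ K) (w : List σ) :
    (∑ i ∈ s, f i) w = ∑ i ∈ s, f i w :=
  map_sum (⟨⟨fun f => f w, rfl⟩, fun _ _ => rfl⟩ : NCPowerSeries σ K →+ K) f s

theorem X_nil (p : σ) : (X p : NCPowerSeries σ K) [] = 0 := by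
  simp [X]

theorem X_mul_cons [DecidableEq σ] (p : σ) (f : NCPowerSeries σ K) (x : σ) (w : List σ) :
    (X p * f : NCPowerSeries σ K) (x :: w) = if x = p then f w else 0 := by
  have h : (X p : NCPowerSeries σ K).tail x = if x = p then 1 else 0 := by
    ext w
    cases w <;> by_cases h : x = p <;> simp [tail, X, h, one_nil, one_cons, zero_apply]
  rw [mul_cons, X_nil, zero_mul, zero_add, h]
  split_ifs
  · rw [one_mul]
  · rw [zero_mul, zero_apply]

theorem pow_apply_eq_zero {f : NCPowerSeries σ K} (hf : f [] = 0) {i : ℕ} {w : List σ}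
    (h : w.length < i) : (f ^ i) w = 0 := by
  induction i generalizing w with
  | zero => omega
  | succ i ih =>
    rw [pow_succ', mul_apply]
    refine Finset.sum_eq_zero fun j _ => ?_
    cases w with
    | nil => simp [hf]
    | cons x w =>
      cases j with
      | zero => simp [hf]
      | succ j =>
        rw [ih, mul_zero]
        simp only [List.drop_succ_cons, List.length_drop, List.length_cons] at h ⊢
        omega

theorem mul_apply_congr {f f' g g' : NCPowerSeries σ K} {w : List σ}
    (hf : ∀ u : List σ, u.length ≤ w.length → f u = f' u)
    (hg : ∀ u : List σ, u.length ≤ w.length → g u = g' u) : (f * g) w = (f' * g') w := by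
  rw [mul_apply, mul_apply]
  refine Finset.sum_congr rfl fun i _ => ?_
  rw [hf _ (by simp), hg _ (by simp)]

/-- The inverse is the geometric series in `1 - f`, whose `i`-th power has no words shorter than
`i`. -/
theorem isUnit_of_nil_eq_one {f : NCPowerSeries σ K} (hf : f [] = 1) : IsUnit f := by
  have hN : (1 - f : NCPowerSeries σ K) [] = 0 := by
    have : (1 - f : NCPowerSeries σ K) [] = 1 - f [] := rfl
    rw [this, hf, sub_self]
  -- At each word the series is cut off at the length of the word; by `hg` any later cut-off gives
  -- the same coefficient.
  let g : NCPowerSeries σ K := fun w =>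
    (∑ i ∈ Finset.range (w.length + 1), (1 - f) ^ i : NCPowerSeries σ K) w
  have hg (M : ℕ) (u : List σ) (hu : u.length ≤ M) :
      g u = (∑ i ∈ Finset.range (M + 1), (1 - f) ^ i : NCPowerSeries σ K) u := by
    change (∑ i ∈ Finset.range (u.length + 1), (1 - f) ^ i : NCPowerSeries σ K) u = _
    rw [sum_apply, sum_apply]
    refine Finset.sum_subset (Finset.range_mono (by omega)) fun i _ hi => ?_
    refine pow_apply_eq_zero hN ?_
    rw [Finset.mem_range] at hi
    omega
  have hpow (w : List σ) : (1 - (1 - f) ^ (w.length + 1) : NCPowerSeries σ K) w =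
      (1 : NCPowerSeries σ K) w := by
    have : (1 - (1 - f) ^ (w.length + 1) : NCPowerSeries σ K) w =
      (1 : NCPowerSeries σ K) w - ((1 - f) ^ (w.length + 1) : NCPowerSeries σ K) w := rfl
    rw [this, pow_apply_eq_zero hN (Nat.lt_succ_self _), sub_zero]
  refine ⟨⟨f, g, ?_, ?_⟩, rfl⟩
  · ext w
    rw [mul_apply_congr (fun _ _ => rfl) (hg w.length), ← hpow w, ← mul_neg_geom_sum, sub_sub_cancel]
  · ext w
    rw [mul_apply_congr (hg w.length) (fun _ _ => rfl), ← hpow w, ← geom_sum_mul_neg, sub_sub_cancel]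

/-- The constant coefficient, as an algebra homomorphism. -/
def constantCoeff : NCPowerSeries σ K →ₐ[K] K where
  toFun f := f []
  map_one' := rfl
  map_mul' := mul_nil
  map_zero' := rfl
  map_add' _ _ := rfl
  commutes' c := by
    rw [Algebra.algebraMap_eq_smul_one, smul_apply, one_nil, mul_one]
    rfl

/-- The series of all words `a s₀ s₁, a s₁ s₂, …, a sₗ (n + j)` with `s₀ = s` and `sᵢ < n`, with
coefficient `c ^ l`. -/
def pathSeries {n k : ℕ} (c : K) (j : Fin k) :
    Fin n → NCPowerSeries (Fin (n + k) × Fin (n + k)) K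
  | _, [] => 0
  | s, x :: w => (if x = (Fin.castAdd k s, Fin.natAdd n j) ∧ w = [] then 1 else 0) +
      c * ∑ t, if x = (Fin.castAdd k s, Fin.castAdd k t) then pathSeries c j t w else 0

theorem pathSeries_eq {n k : ℕ} (c : K) (j : Fin k) (s : Fin n) :
    pathSeries c j s = X (Fin.castAdd k s, Fin.natAdd n j) +
      c • ∑ t, X (Fin.castAdd k s, Fin.castAdd k t) * pathSeries c j t := by
  ext w
  rw [add_apply, smul_apply, sum_apply]
  cases w with
  | nil => simp [pathSeries, X_nil, mul_nil]
  | cons x w =>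
    simp only [X_mul_cons]
    rw [pathSeries]
    congr 1
    simp [X]

end NCPowerSeries

/-! ### The Sylvester identity. -/

section Sylvester

theorem map_qDetOneSub {m : ℕ} {R S : Type*} [Ring R] [Algebra ℂ R] [Ring S] [Algebra ℂ S]
    (f : R →ₐ[ℂ] S) (q : ℂ) (A : Matrix (Fin m) (Fin m) R) :
    f (qDetOneSub q A) = qDetOneSub q (A.map f) := by
  have h : f.comp (NCPoly.evalAt A) = NCPoly.evalAt (A.map f) := by
    refine MonoidAlgebra.algHom_ext (fun w => ?_) (Subsingleton.elim _ _)
    induction w using FreeMonoid.inductionOn' with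
    | one => simp [NCPoly.evalAt]
    | of_mul p w ih =>
      simp only [NCPoly.evalAt, AlgHom.comp_apply, MonoidAlgebra.lift_single, one_smul, map_mul,
        FreeMonoid.lift_eval_of, Matrix.map_apply] at ih ⊢
      rw [ih]
  exact DFunLike.congr_fun h _

/-- Only the empty word survives at zero, and its weight is `1`. -/
theorem evalAt_zero_applyQWeight {m : ℕ} (q : ℂ) (p : NCPoly m) :
    NCPoly.evalAt (0 : Matrix (Fin m) (Fin m) ℂ) (applyQWeight q p) = NCPoly.evalAt 0 p := by
  induction p using MonoidAlgebra.induction_linear with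
  | zero => simp [applyQWeight]
  | add f g hf hg => rw [applyQWeight_add, map_add, map_add, hf, hg]
  | single w c =>
    rw [applyQWeight_single]
    simp only [NCPoly.evalAt, MonoidAlgebra.lift_single]
    cases w using FreeMonoid.casesOn with
    | one => simp [qWeight, wordInv]
    | of_mul p w => simp

theorem qDetOneSub_zero {m : ℕ} (q : ℂ) : qDetOneSub q (0 : Matrix (Fin m) (Fin m) ℂ) = 1 := by
  rw [qDetOneSub, qDet, evalAt_zero_applyQWeight, ← Matrix.det_one (n := Fin m), Matrix.det_apply,
    map_sum]
  refine Finset.sum_congr rfl fun s _ => ?_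
  rw [map_zsmul, map_list_prod, List.map_ofFn, List.prod_ofFn]
  congr 1
  refine Finset.prod_congr rfl fun j _ => ?_
  simp only [Function.comp_apply, Matrix.sub_apply, map_sub, NCPoly.genMatrix, Matrix.of_apply,
    evalAt_var, Matrix.zero_apply, sub_zero, Matrix.one_apply]
  split_ifs <;> simp

theorem columnsDesc_add (n k : ℕ) : columnsDesc (n + k) = extendColumns n (columnsDesc k) := by
  have h : List.finRange (n + k) = (List.finRange n).map (Fin.castAdd k) ++
      (List.finRange k).map (Fin.natAdd n) := by
    rw [← List.ofFn_id, ← List.ofFn_id, ← List.ofFn_id, List.ofFn_add, List.map_ofFn, List.map_ofFn]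
    rfl
  rw [columnsDesc, h, List.reverse_append, ← List.map_reverse, ← List.map_reverse]
  rfl

theorem extendRows_univ (n k : ℕ) :
    extendRows n (Finset.univ : Finset (Fin k)) = Finset.univ := by
  ext x
  refine Fin.addCases (fun s => ?_) (fun i => ?_) x
  · simp [castAdd_mem_extendRows]
  · simp [natAdd_mem_extendRows]

variable {n k : ℕ} {R : Type*} [Ring R] [Algebra ℂ R]

theorem qMinor_upperLeft (q : ℂ) {e : Fin (n + k) → ℂ} (he : ∀ s, e (Fin.castAdd k s) = 1)
    (A : Matrix (Fin (n + k)) (Fin (n + k)) R) :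
    qMinor q e A (extendColumns n ([] : List (Fin k))) (extendRows n ∅) =
      qMinor q (fun _ => 1) (upperLeft A) (columnsDesc n) Finset.univ := by
  have h := qMinor_map q e A (Fin.castAddOrderEmb k) (columnsDesc n) Finset.univ
  have he' : e ∘ Fin.castAddOrderEmb k = fun _ => 1 := funext he
  rw [he'] at h
  refine Eq.trans ?_ h
  rw [extendRows, Finset.map_empty, Finset.union_empty]
  rfl

/-- The factorization of `qMinor_extend` for all rows and columns. -/
theorem qMinor_univ_eq_mul {q : ℂ} (hq : q ≠ 0) {e : Fin (n + k) → ℂ}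
    (he : ∀ s, e (Fin.castAdd k s) = 1) {A : Matrix (Fin (n + k)) (Fin (n + k)) R}
    (hA : IsQCartierFoata q A) {v : Matrix (Fin n) (Fin k) R}
    (hv : ∀ s j, v s j - q⁻¹ • ∑ t, A (Fin.castAdd k s) (Fin.castAdd k t) * v t j =
      A (Fin.castAdd k s) (Fin.natAdd n j)) :
    qMinor q e A (columnsDesc (n + k)) Finset.univ =
      qDetOneSub q (upperLeft A) *
        qMinor q (fun j => e (Fin.natAdd n j)) (schurMatrix q A v) (columnsDesc k)
          Finset.univ := by
  rw [columnsDesc_add, ← extendRows_univ, qMinor_extend hq he hA hv _ _ (by simp [length_columnsDesc]),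
    qMinor_upperLeft q he, qDetOneSub_eq_qMinor hq]

/-- The order embedding with image `0, …, n - 1, n + i`. -/
def borderEmb (n : ℕ) {k : ℕ} (i : Fin k) : Fin (n + 1) ↪o Fin (n + k) :=
  OrderEmbedding.ofStrictMono (Fin.addCases (Fin.castAdd k) fun _ : Fin 1 => Fin.natAdd n i) (by
    intro a b
    refine Fin.addCases (fun s => ?_) (fun x => ?_) a <;>
      refine Fin.addCases (fun t => ?_) (fun y => ?_) b
    · simp [castAdd_lt_castAdd]
    · simp [castAdd_lt_natAdd]
    · simp [(castAdd_lt_natAdd _ _).le]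
    · simp [Subsingleton.elim x y])

theorem borderEmb_castAdd (i : Fin k) (s : Fin n) :
    borderEmb n i (Fin.castAdd 1 s) = Fin.castAdd k s :=
  Fin.addCases_left (motive := fun _ => Fin (n + k)) (left := Fin.castAdd k)
    (right := fun _ : Fin 1 => Fin.natAdd n i) s

theorem borderEmb_natAdd (i : Fin k) (x : Fin 1) :
    borderEmb n i (Fin.natAdd n x) = Fin.natAdd n i :=
  Fin.addCases_right (motive := fun _ => Fin (n + k)) (left := Fin.castAdd k)
    (right := fun _ : Fin 1 => Fin.natAdd n i) x

theorem IsQCartierFoata.submatrix {m r : ℕ} {q : ℂ} {A : Matrix (Fin m) (Fin m) R}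
    (hA : IsQCartierFoata q A) (f g : Fin r ↪o Fin m) : IsQCartierFoata q (A.submatrix f g) where
  comm_of_lt _ _ _ _ h h' := hA.comm_of_lt _ _ _ _ (f.strictMono h) (g.strictMono h')
  comm_of_gt _ _ _ _ h h' := hA.comm_of_gt _ _ _ _ (f.strictMono h) (g.strictMono h')
  comm_same _ _ _ h := hA.comm_same _ _ _ (f.strictMono h)

/-- The diagonal `1, …, 1, 0` of the bordered matrix without its variables. -/
def borderDiag (n : ℕ) : Fin (n + 1) → ℂ := Fin.addCases (fun _ => 1) fun _ : Fin 1 => 0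

theorem borderedMatrix_eq (i j : Fin k) :
    borderedMatrix n k i j =
      Matrix.of (diagSubVar (borderDiag n) (borderEmb n i) (borderEmb n j)) := by
  ext a b
  refine Fin.addCases (fun s => ?_) (fun x => ?_) a <;>
    refine Fin.addCases (fun t => ?_) (fun y => ?_) b
  · simp [borderedMatrix, diagSubVar, borderDiag, borderEmb_castAdd, Matrix.one_apply, upperLeft,
      NCPoly.genMatrix]
  · have h : Fin.castAdd 1 s ≠ Fin.natAdd n y := (castAdd_lt_natAdd _ _).ne
    simp [borderedMatrix, diagSubVar, borderEmb_castAdd, borderEmb_natAdd, h]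
  · have h : Fin.natAdd n x ≠ Fin.castAdd 1 t := (castAdd_lt_natAdd _ _).ne'
    simp [borderedMatrix, diagSubVar, borderEmb_castAdd, borderEmb_natAdd, h]
  · simp [borderedMatrix, diagSubVar, borderDiag, borderEmb_natAdd]

/-- The Schur factorization with a single extra row and column: the remaining minor has size one,
and its scalar part is `0` by the choice of `borderDiag`. -/
theorem evalAt_qDet_borderedMatrix {q : ℂ} (hq : q ≠ 0)
    {A : Matrix (Fin (n + k)) (Fin (n + k)) R} (hA : IsQCartierFoata q A)
    {v : Matrix (Fin n) (Fin k) R}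
    (hv : ∀ s j, v s j - q⁻¹ • ∑ t, A (Fin.castAdd k s) (Fin.castAdd k t) * v t j =
      A (Fin.castAdd k s) (Fin.natAdd n j)) (i j : Fin k) :
    NCPoly.evalAt A (qDet q (borderedMatrix n k i j)) =
      -(qDetOneSub q (upperLeft A) * schurMatrix q A v i j) := by
  have hup : upperLeft (A.submatrix (borderEmb n i) (borderEmb n j)) = upperLeft A := by
    ext s t
    simp [upperLeft, borderEmb_castAdd]
  rw [borderedMatrix_eq, evalAt_qDet hq,
    qMinor_univ_eq_mul hq (k := 1) (by simp [borderDiag])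
      (hA.submatrix (borderEmb n i) (borderEmb n j)) (v := Matrix.of fun s _ => v s j), hup]
  · have hcols : columnsDesc 1 = [0] := rfl
    have hrows : (Finset.univ : Finset (Fin 1)).filter (0 < ·) = ∅ := rfl
    rw [hcols, qMinor_cons, ← mul_neg, Fin.sum_univ_one, hrows]
    simp [qMinor_nil, qEntry, borderDiag, schurMatrix, borderEmb_natAdd, borderEmb_castAdd]
  · intro s y
    simpa [borderEmb_natAdd, borderEmb_castAdd] using hv s j

/-- Units are preserved by `φ`, so it suffices to treat the power series ring, where the constant
term is `det_q` of the identity, namely `1`. -/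
theorem isUnit_qDetOneSub_upperLeft (q : ℂ)
    (φ : NCPowerSeries (Fin (n + k) × Fin (n + k)) ℂ →ₐ[ℂ] R) :
    IsUnit (qDetOneSub q (upperLeft (imageMatrix φ))) := by
  have h : upperLeft (imageMatrix φ) = (upperLeft (imageMatrix (AlgHom.id ℂ _))).map φ := rfl
  rw [h, ← map_qDetOneSub]
  refine (NCPowerSeries.isUnit_of_nil_eq_one ?_).map φ
  have h0 : (upperLeft (imageMatrix (AlgHom.id ℂ _))).map
      (NCPowerSeries.constantCoeff (σ := Fin (n + k) × Fin (n + k)) (K := ℂ)) = 0 := by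
    ext i j
    exact NCPowerSeries.X_nil (K := ℂ) (Fin.castAdd k i, Fin.castAdd k j)
  have h1 := map_qDetOneSub (NCPowerSeries.constantCoeff (σ := Fin (n + k) × Fin (n + k)) (K := ℂ))
    q (upperLeft (imageMatrix (AlgHom.id ℂ _)))
  rw [h0, qDetOneSub_zero] at h1
  exact h1

end Sylvester

theorem theorem8p5 (q : ℂ) (hq : q ≠ 0) (n k : ℕ) (hk : 0 < k)
    {R : Type*} [Ring R] [Algebra ℂ R]
    (φ : NCPowerSeries (Fin (n + k) × Fin (n + k)) ℂ →ₐ[ℂ] R)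
    (A : Matrix (Fin (n + k)) (Fin (n + k)) R) (hφ : A = imageMatrix φ)
    (hA : IsQCartierFoata q A) :
    IsUnit (qDetOneSub q (upperLeft A)) ∧
      Ring.inverse (qDetOneSub q (upperLeft A)) * qDetOneSub q A =
        qDetOneSub q (sylvesterC q A) := by
  have hunit : IsUnit (qDetOneSub q (upperLeft A)) := hφ ▸ isUnit_qDetOneSub_upperLeft q φ
  refine ⟨hunit, ?_⟩
  -- The path series solves the linear system in the free power series ring; `φ` transports the
  -- solution to `R`, where infinite sums need not make sense.
  let v : Matrix (Fin n) (Fin k) R :=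
    Matrix.of fun s j => φ (NCPowerSeries.pathSeries q⁻¹ j s)
  have hv (s j) : v s j - q⁻¹ • ∑ t, A (Fin.castAdd k s) (Fin.castAdd k t) * v t j =
      A (Fin.castAdd k s) (Fin.natAdd n j) := by
    have h := congrArg φ (NCPowerSeries.pathSeries_eq (n := n) q⁻¹ j s)
    rw [map_add, map_smul, map_sum] at h
    simp only [map_mul] at h
    rw [sub_eq_iff_eq_add, hφ]
    exact h
  have hC : sylvesterC q A = schurMatrix q A v := by
    ext i j
    rw [sylvesterC, Matrix.of_apply, evalAt_qDet_borderedMatrix hq hA hv, mul_neg, neg_neg,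
      Ring.inverse_mul_cancel_left _ _ hunit]
  rw [hC, qDetOneSub_eq_qMinor hq A, qMinor_univ_eq_mul hq (fun _ => rfl) hA hv,
    Ring.inverse_mul_cancel_left _ _ hunit, qDetOneSub_eq_qMinor hq]
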